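/- Let $p$ be a prime. A $p$-graph $\Gamma=(\mathcal G,f)$ consists of a finite oriented graph $\mathcal G=(\mathcal V,\mathcal E)$, $\mathcal E\subseteq\mathcal V\times\mathcal V$, without loops and such that $(v,w)\in\mathcal E$ implies $(w,v)\notin\mathcal E$, and of a labelling $f=(f_1,f_2)\colon\mathcal E\to p\mathbb Z_p\times p\mathbb Z_p$ if $p\ne 2$, respectively $f\colon\mathcal E\to 4\mathbb Z_2\times 4\mathbb Z_2$ if $p=2$. The associated $p$-RAAG is the pro-$p$ group given by the pro-$p$ presentation $$G_\Gamma=\langle\, \mathcal V \mid [v,w]=v^{f_1(e)}w^{f_2(e)}\ \text{for each } e=(v,w)\in\mathcal E\,\rangle,\qquad [v,w]=v^{-1}w^{-1}vw.$$ For an $\mathbb F_p$-vector space $W$ and $\Omega\subseteq W\otimes W$ put $Q(W,\Omega)=T_\bullet(W)/(\Omega)$, the quotient of the tensor algebra by the two-sided ideal generated by $\Omega$, with the grading induced by that of $T_\bullet(W)$. A pro-$p$ group $G$ is $H^\bullet$-quadratic if its continuous cohomology algebra $H^\bullet(G,\mathbb F_p)=\bigoplus_{n\ge0}H^n(G,\mathbb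 F_p)$ (trivial coefficients, cup product) is isomorphic, as a graded algebra, to $Q(H^1(G,\mathbb F_p),\Omega)$ for some $\Omega\subseteq H^1(G,\mathbb F_p)\otimes H^1(G,\mathbb F_p)$. Let $\mathbb F_p\langle\mathcal V\rangle$ be the $\mathbb F_p$-vector space with basis $\mathcal V$ and let $\Lambda_\bullet(\mathcal G^{\mathrm{op}})=Q(\mathbb F_p\langle\mathcal V\rangle,\Omega)$ with $$\Omega=\{x\otimes x \mid x\in\mathbb F_p\langle\mathcal V\rangle\}\cup\{v\otimes w\mid v,w\in\mathcal V,\ (v,w)\notin\mathcal E,\ (w,v)\notin\mathcal E\},$$ that is, the exterior algebra on $\mathbb F_p\langle\mathcal V\rangle$ modulo the ideal generated by the products $v\wedge w$ of vertices $v,w$ that are not joined by an edge of $\mathcal G$. **Theorem.** If $G_\Gamma$ is $H^\bullet$-quadratic, then there is an isomorphism of graded $\mathbb F_p$-algebras $$H^\bullet(G_\Gamma,\mathbb F_p)\cong\Lambda_\bullet(\mathcal G^{\mathrm{op}}).$$ -/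

import Mathlib

/-! ## Continuous cochain cohomology with trivial discrete coefficients -/

namespace ContCoh

set_option linter.unusedSectionVars false

section Cochains

variable (k : Type*) [CommRing k] (G : Type*) [Group G] [TopologicalSpace G]

/-- Continuous `n`-cochains `Gⁿ → k`, where `k` carries the discrete topology. -/
abbrev Cochain (n : ℕ) : Type _ := LocallyConstant (Fin n → G) k

variable {G}

/-- `(g₀, …, gₙ) ↦ (g₁, …, gₙ)`. -/
def tailMap (n : ℕ) : C(Fin (n + 1) → G, Fin n → G) where
  toFun g i := g i.succ
  continuous_toFun := by fun_prop

/-- `(g₀, …, gₙ) ↦ (g₀, …, gⱼ gⱼ₊₁, …, gₙ)` for `j < n`, and `(g₀, …, gₙ₋₁)` for `j = n`. -/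
def contractMap [ContinuousMul G] {n : ℕ} (j : Fin (n + 1)) :
    C(Fin (n + 1) → G, Fin n → G) where
  toFun g := Fin.contractNth j (· * ·) g
  continuous_toFun := by
    refine continuous_pi fun i => ?_
    unfold Fin.contractNth
    split_ifs <;> fun_prop

/-- `(g₀, …, gₘ₊ₙ₋₁) ↦ (g₀, …, gₘ₋₁)`. -/
def frontMap (m n : ℕ) : C(Fin (m + n) → G, Fin m → G) where
  toFun g i := g (Fin.castAdd n i)
  continuous_toFun := by fun_prop

/-- `(g₀, …, gₘ₊ₙ₋₁) ↦ (gₘ, …, gₘ₊ₙ₋₁)`. -/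
def backMap (m n : ℕ) : C(Fin (m + n) → G, Fin n → G) where
  toFun g i := g (Fin.natAdd m i)
  continuous_toFun := by fun_prop

variable (G)

/-- The differential of the inhomogeneous cochain complex (trivial action on `k`). -/
noncomputable def d [ContinuousMul G] (n : ℕ) : Cochain k G n →ₗ[k] Cochain k G (n + 1) :=
  LocallyConstant.comapₗ k (tailMap n) +
    ∑ j : Fin (n + 1), (-1 : k) ^ ((j : ℕ) + 1) • LocallyConstant.comapₗ k (contractMap j)

/-- The cup product of cochains,
`(a ⌣ b)(g₀, …, gₘ₊ₙ₋₁) = a(g₀, …, gₘ₋₁) b(gₘ, …, gₘ₊ₙ₋₁)`. -/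
noncomputable def cup (m n : ℕ) :
    Cochain k G m →ₗ[k] Cochain k G n →ₗ[k] Cochain k G (m + n) :=
  (LinearMap.mul k (Cochain k G (m + n))).compl₁₂
    (LocallyConstant.comapₗ k (frontMap m n)) (LocallyConstant.comapₗ k (backMap m n))

/-- The unit cochain of degree `0`. -/
noncomputable def oneCochain : Cochain k G 0 := 1

variable [ContinuousMul G]

/-- Cocycles. -/
noncomputable def Z (n : ℕ) : Submodule k (Cochain k G n) := LinearMap.ker (d k G n)

/-- Coboundaries. -/
noncomputable def B : (n : ℕ) → Submodule k (Cochain k G n)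
  | 0 => ⊥
  | n + 1 => LinearMap.range (d k G n)

/-- The continuous cohomology `Hⁿ(G, k)`: cocycles modulo coboundaries. -/
def H (n : ℕ) : Type _ := Z k G n ⧸ (B k G n).comap (Z k G n).subtype

noncomputable instance (n : ℕ) : AddCommGroup (H k G n) :=
  inferInstanceAs (AddCommGroup (Z k G n ⧸ (B k G n).comap (Z k G n).subtype))

noncomputable instance (n : ℕ) : Module k (H k G n) :=
  inferInstanceAs (Module k (Z k G n ⧸ (B k G n).comap (Z k G n).subtype))

end Cochains

section Aux

variable {k : Type*} [CommRing k] {G : Type*} [Group G] [TopologicalSpace G]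

/-- A cochain evaluated on the initial segment of an infinite sequence. -/
def ev {n : ℕ} (a : Cochain k G n) (g : ℕ → G) : k := a fun i => g i

/-- The faces of an infinite sequence. -/
def face (j : ℕ) (g : ℕ → G) (i : ℕ) : G :=
  if i + 1 < j then g i else if i + 1 = j then g i * g (i + 1) else g (i + 1)

theorem ev_ext {n : ℕ} {a b : Cochain k G n} (h : ∀ g, ev a g = ev b g) : a = b := by
  ext x
  have := h fun i => if hi : i < n then x ⟨i, hi⟩ else 1
  simpa [ev] using this

theorem ev_congr {n : ℕ} (a : Cochain k G n) {g g' : ℕ → G} (h : ∀ i < n, g i = g' i) :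
    ev a g = ev a g' := by
  unfold ev
  congr 1
  ext i
  exact h i i.2

theorem ev_cup {m n : ℕ} (a : Cochain k G m) (b : Cochain k G n) (g : ℕ → G) :
    ev (cup k G m n a b) g = ev a g * ev b fun i => g (m + i) := by
  simp [ev, cup, LocallyConstant.comapₗ, frontMap, backMap]

theorem ev_d [ContinuousMul G] {n : ℕ} (a : Cochain k G n) (g : ℕ → G) :
    ev (d k G n a) g = ∑ j ∈ Finset.range (n + 2), (-1 : k) ^ j * ev a (face j g) := by
  rw [Finset.sum_range_succ', Finset.sum_range]
  simp only [ev, d, LinearMap.add_apply, LinearMap.sum_apply, LinearMap.smul_apply,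
    LocallyConstant.coe_add, Pi.add_apply, pow_zero, one_mul]
  rw [add_comm]
  congr 1
  rw [← LocallyConstant.coeFnAddMonoidHom_apply, map_sum, Finset.sum_apply]
  refine Finset.sum_congr rfl fun j _ => ?_
  simp only [LocallyConstant.coeFnAddMonoidHom_apply, LocallyConstant.coe_smul, Pi.smul_apply,
    smul_eq_mul]
  congr 1
  change a _ = a _
  congr 1
  ext i
  simp [contractMap, Fin.contractNth, face]


/-- The Leibniz rule. -/
theorem ev_d_cup [ContinuousMul G] {m n : ℕ} (a : Cochain k G m) (b : Cochain k G n)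
    (g : ℕ → G) :
    ev (d k G (m + n) (cup k G m n a b)) g =
      ev (d k G m a) g * ev b (fun i => g (m + 1 + i)) +
        (-1 : k) ^ m * (ev a g * ev (d k G n b) fun i => g (m + i)) := by
  simp only [ev_d, ev_cup]
  rw [show m + n + 2 = (m + 1) + (n + 1) by ring, Finset.sum_range_add,
    Finset.sum_range_succ _ (m + 1), Finset.sum_range_succ' _ (n + 1)]
  have h1 : ∀ j ∈ Finset.range (m + 1),
      (-1 : k) ^ j * (ev a (face j g) * ev b fun i => face j g (m + i)) =
        (-1 : k) ^ j * ev a (face j g) * ev b (fun i => g (m + 1 + i)) := by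
    intro j hj
    rw [Finset.mem_range] at hj
    rw [mul_assoc]
    congr 3
    ext i
    rw [face, if_neg (by omega), if_neg (by omega)]
    congr 1
    omega
  have h2 : ∀ l ∈ Finset.range (n + 1),
      (-1 : k) ^ (m + 1 + l) *
        (ev a (face (m + 1 + l) g) * ev b fun i => face (m + 1 + l) g (m + i)) =
      (-1 : k) ^ m * (ev a g * ((-1 : k) ^ (l + 1) * ev b (face (l + 1) fun i => g (m + i)))) := by
    intro l _
    rw [ev_congr a (g := face (m + 1 + l) g) (g' := g)
      (fun i hi => by rw [face, if_pos (by omega)])]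
    rw [show (fun i => face (m + 1 + l) g (m + i)) = face (l + 1) fun i => g (m + i) by
      ext i
      simp only [face, show m + i + 1 < m + 1 + l ↔ i + 1 < l + 1 by omega,
        show m + i + 1 = m + 1 + l ↔ i + 1 = l + 1 by omega]
      rfl]
    ring
  rw [Finset.sum_congr rfl h1, Finset.sum_congr rfl h2, ← Finset.sum_mul, ← Finset.mul_sum,
    ← Finset.mul_sum]
  rw [ev_congr a (g := face (m + 1) g) (g' := g)
      (fun i hi => by rw [face, if_pos (by omega)])]
  rw [show (face 0 fun i => g (m + i)) = fun i => g (m + 1 + i) by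
    ext i
    simp only [face]
    rw [if_neg (by omega), if_neg (by omega)]
    congr 1
    omega]
  ring

theorem face_face {i j : ℕ} (h : i ≤ j) (g : ℕ → G) :
    face i (face (j + 1) g) = face j (face i g) := by
  ext l
  unfold face
  split_ifs <;> first | rfl | omega | (simp only [mul_assoc])

theorem d_d [ContinuousMul G] {n : ℕ} (a : Cochain k G n) : d k G (n + 1) (d k G n a) = 0 := by
  refine ev_ext fun g => ?_
  simp only [ev_d, Finset.mul_sum]
  change _ = (0 : k)
  rw [Finset.sum_sigma']
  refine Finset.sum_involution
    (fun x _ => if x.2 < x.1 then ⟨x.2, x.1 - 1⟩ else ⟨x.2 + 1, x.1⟩) ?_ ?_ ?_ ?_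
  · rintro ⟨j, i⟩ hx
    dsimp only
    split_ifs with hij
    · obtain ⟨j, rfl⟩ : ∃ j', j = j' + 1 := ⟨j - 1, by omega⟩
      dsimp only
      rw [Nat.add_sub_cancel, face_face (by omega)]
      ring
    · dsimp only
      rw [face_face (by omega)]
      ring
  · rintro ⟨j, i⟩ hx _ h
    dsimp only at h
    split_ifs at h with hij <;> simp at h <;> omega
  · rintro ⟨j, i⟩ hx
    simp only [Finset.mem_sigma, Finset.mem_range] at hx ⊢
    split_ifs with hij <;> dsimp only <;> omega
  · rintro ⟨j, i⟩ hx
    dsimp only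
    by_cases hij : i < j
    · simp only [hij, if_true]
      rw [if_neg (by omega)]
      simp only [Sigma.mk.injEq, heq_eq_eq, and_true]
      omega
    · simp only [hij, if_false]
      rw [if_pos (by omega)]
      simp

theorem B_le_Z [ContinuousMul G] (n : ℕ) : B k G n ≤ Z k G n := by
  cases n with
  | zero => exact bot_le
  | succ n =>
    rintro _ ⟨a, rfl⟩
    exact d_d a

variable [ContinuousMul G]

theorem cup_mem_Z {m n : ℕ} {a : Cochain k G m} {b : Cochain k G n} (ha : a ∈ Z k G m)
    (hb : b ∈ Z k G n) : cup k G m n a b ∈ Z k G (m + n) := by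
  refine ev_ext fun g => ?_
  rw [ev_d_cup, LinearMap.mem_ker.1 ha, LinearMap.mem_ker.1 hb]
  simp [ev]

theorem mem_B_of_ev {N n : ℕ} (h : N = n + 1) {c : Cochain k G N} (x : Cochain k G n)
    (hx : ∀ g, ev c g = ev (d k G n x) g) : c ∈ B k G N := by
  subst h
  exact ⟨x, (ev_ext hx).symm⟩

theorem cup_mem_B_left {m n : ℕ} {a : Cochain k G m} {b : Cochain k G n} (ha : a ∈ B k G m)
    (hb : b ∈ Z k G n) : cup k G m n a b ∈ B k G (m + n) := by
  cases m with
  | zero =>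
    obtain rfl : a = 0 := ha
    simp
  | succ m =>
    obtain ⟨x, rfl⟩ := ha
    refine mem_B_of_ev (by omega) (cup k G m n x b) fun g => ?_
    rw [ev_d_cup, LinearMap.mem_ker.1 hb, ev_cup]
    simp [ev]

theorem cup_mem_B_right {m n : ℕ} {a : Cochain k G m} {b : Cochain k G n} (ha : a ∈ Z k G m)
    (hb : b ∈ B k G n) : cup k G m n a b ∈ B k G (m + n) := by
  cases n with
  | zero =>
    obtain rfl : b = 0 := hb
    simp
  | succ n =>
    obtain ⟨x, rfl⟩ := hb
    refine mem_B_of_ev rfl ((-1 : k) ^ m • cup k G m n a x) fun g => ?_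
    rw [map_smul]
    refine Eq.trans ?_ (show ev ((-1 : k) ^ m • d k G (m + n) (cup k G m n a x)) g =
      (-1 : k) ^ m * ev (d k G (m + n) (cup k G m n a x)) g from rfl).symm
    rw [ev_d_cup, ev_cup,
      LinearMap.mem_ker.1 ha]
    simp only [ev, LocallyConstant.coe_zero, Pi.zero_apply, zero_mul, zero_add]
    rw [← mul_assoc, ← pow_add, Even.neg_one_pow ⟨m, rfl⟩, one_mul]

theorem one_mem_Z : oneCochain k G ∈ Z k G 0 := by
  refine ev_ext fun g => ?_
  rw [ev_d]
  simp [Finset.sum_range_succ, ev, oneCochain]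

end Aux

section Algebra

variable (k : Type*) [CommRing k] (G : Type*) [Group G] [TopologicalSpace G] [ContinuousMul G]

/-- The cup product of cocycles. -/
noncomputable def cupZ (m n : ℕ) : Z k G m →ₗ[k] Z k G n →ₗ[k] Z k G (m + n) :=
  LinearMap.mk₂ k (fun a b => ⟨cup k G m n a b, cup_mem_Z a.2 b.2⟩)
    (fun _ _ _ => Subtype.ext (by simp)) (fun _ _ _ => Subtype.ext (by simp))
    (fun _ _ _ => Subtype.ext (by simp)) (fun _ _ _ => Subtype.ext (by simp))

/-- The class of a cocycle. -/
noncomputable def cls (n : ℕ) : Z k G n →ₗ[k] H k G n :=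
  Submodule.mkQ ((B k G n).comap (Z k G n).subtype)

theorem cls_surjective (n : ℕ) : Function.Surjective (cls k G n) := Submodule.mkQ_surjective _

theorem cls_eq_zero_iff {n : ℕ} (a : Z k G n) : cls k G n a = 0 ↔ (a : Cochain k G n) ∈ B k G n :=
  Submodule.Quotient.mk_eq_zero _

/-- The cup product on cohomology, `[a] ⌣ [b] = [a ⌣ b]`. -/
noncomputable def cupH (m n : ℕ) : H k G m →ₗ[k] H k G n →ₗ[k] H k G (m + n) :=
  Submodule.liftQ ((B k G m).comap (Z k G m).subtype)
    (LinearMap.flip <| Submodule.liftQ ((B k G n).comap (Z k G n).subtype)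
      ((cupZ k G m n).compr₂ (cls k G (m + n))).flip (by
        intro b hb
        refine LinearMap.mem_ker.2 <| LinearMap.ext fun a => ?_
        exact (cls_eq_zero_iff k G _).2 (cup_mem_B_right a.2 hb)))
    (by
      intro a ha
      refine LinearMap.mem_ker.2 <| LinearMap.ext fun b => ?_
      obtain ⟨b, rfl⟩ := cls_surjective k G _ b
      exact (cls_eq_zero_iff k G _).2 (cup_mem_B_left ha b.2))

theorem cupH_cls {m n : ℕ} (a : Z k G m) (b : Z k G n) :
    cupH k G m n (cls k G m a) (cls k G n b) = cls k G (m + n) (cupZ k G m n a b) := rfl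

/-- The unit cocycle. -/
noncomputable def oneZ : Z k G 0 := ⟨oneCochain k G, one_mem_Z⟩

/-- The unit class. -/
noncomputable def oneH : H k G 0 := cls k G 0 (oneZ k G)

variable {k G}

theorem gradedMk_eq {m n : ℕ} (h : m = n) {a : Z k G m} {b : Z k G n}
    (hab : ∀ g, ev (a : Cochain k G m) g = ev (b : Cochain k G n) g) :
    GradedMonoid.mk (A := H k G) m (cls k G m a) = GradedMonoid.mk n (cls k G n b) := by
  subst h
  congr 2
  exact Subtype.ext (ev_ext hab)

variable (k G)

noncomputable instance : GradedMonoid.GMul (H k G) where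
  mul {m n} a b := cupH k G m n a b

noncomputable instance : GradedMonoid.GOne (H k G) where
  one := oneH k G

/-- The cohomology groups with the cup product form a graded ring. -/
noncomputable instance : DirectSum.GRing (H k G) where
  mul_zero a := map_zero (cupH k G _ _ a)
  zero_mul b := LinearMap.map_zero₂ (cupH k G _ _) b
  mul_add a b c := map_add (cupH k G _ _ a) b c
  add_mul a b c := LinearMap.map_add₂ (cupH k G _ _) a b c
  one_mul := by
    rintro ⟨n, a⟩
    obtain ⟨a, rfl⟩ := cls_surjective k G _ a
    refine gradedMk_eq (zero_add n) fun g => ?_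
    refine (ev_cup _ _ _).trans ?_
    simp [ev, oneZ, oneCochain]
  mul_one := by
    rintro ⟨n, a⟩
    obtain ⟨a, rfl⟩ := cls_surjective k G _ a
    refine gradedMk_eq (add_zero n) fun g => ?_
    refine (ev_cup _ _ _).trans ?_
    simp [ev, oneZ, oneCochain]
  mul_assoc := by
    rintro ⟨l, a⟩ ⟨m, b⟩ ⟨n, c⟩
    obtain ⟨a, rfl⟩ := cls_surjective k G _ a
    obtain ⟨b, rfl⟩ := cls_surjective k G _ b
    obtain ⟨c, rfl⟩ := cls_surjective k G _ c
    refine gradedMk_eq (add_assoc l m n) fun g => ?_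
    refine (ev_cup _ _ _).trans ?_
    refine Eq.trans ?_ (ev_cup _ _ _).symm
    refine (congrArg (· * _) (ev_cup _ _ _)).trans ?_
    refine Eq.trans ?_ (congrArg (_ * ·) (ev_cup _ _ _)).symm
    rw [mul_assoc]
    congr 3
    ext i
    exact congrArg g (add_assoc l m i)
  natCast n := n • oneH k G
  natCast_zero := zero_smul _ _
  natCast_succ n := succ_nsmul _ _
  intCast n := n • oneH k G
  intCast_ofNat n := natCast_zsmul _ _
  intCast_negSucc_ofNat n := negSucc_zsmul _ _

theorem mk_mul_mk {m n : ℕ} (a : Z k G m) (b : Z k G n) :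
    GradedMonoid.mk (A := H k G) m (cls k G m a) * GradedMonoid.mk n (cls k G n b) =
      GradedMonoid.mk (m + n) (cls k G (m + n) (cupZ k G m n a b)) := rfl

/-- The structure map `k → H⁰(G, k)`. -/
noncomputable def scalarH : k →ₗ[k] H k G 0 :=
  (cls k G 0).comp (LinearMap.toSpanSingleton k (Z k G 0) (oneZ k G))

theorem scalarH_apply (r : k) : scalarH k G r = cls k G 0 (r • oneZ k G) := rfl

/-- The cohomology ring is a `k`-algebra. -/
noncomputable instance : DirectSum.GAlgebra k (H k G) where
  toFun := (scalarH k G).toAddMonoidHom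
  map_one := by
    change scalarH k G 1 = oneH k G
    rw [scalarH_apply, one_smul, oneH]
  map_mul r s := by
    change GradedMonoid.mk 0 (scalarH k G (r * s)) =
      GradedMonoid.mk 0 (scalarH k G r) * GradedMonoid.mk 0 (scalarH k G s)
    rw [scalarH_apply, scalarH_apply, scalarH_apply, mk_mul_mk]
    refine gradedMk_eq rfl fun g => ?_
    refine Eq.trans ?_ (ev_cup _ _ _).symm
    simp [ev, oneZ, oneCochain]
  commutes := by
    rintro r ⟨n, a⟩
    obtain ⟨a, rfl⟩ := cls_surjective k G _ a
    change GradedMonoid.mk 0 (scalarH k G r) * GradedMonoid.mk n (cls k G n a) =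
      GradedMonoid.mk n (cls k G n a) * GradedMonoid.mk 0 (scalarH k G r)
    rw [scalarH_apply, mk_mul_mk, mk_mul_mk]
    refine gradedMk_eq ((zero_add n).trans (add_zero n).symm) fun g => ?_
    refine (ev_cup _ _ _).trans (Eq.trans ?_ (ev_cup _ _ _).symm)
    simp [ev, oneZ, oneCochain, mul_comm]
  smul_def := by
    rintro r ⟨n, a⟩
    obtain ⟨a, rfl⟩ := cls_surjective k G _ a
    change GradedMonoid.mk n (r • cls k G n a) =
      GradedMonoid.mk 0 (scalarH k G r) * GradedMonoid.mk n (cls k G n a)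
    rw [scalarH_apply, mk_mul_mk, ← map_smul]
    refine gradedMk_eq (zero_add n).symm fun g => ?_
    refine Eq.trans ?_ (ev_cup _ _ _).symm
    simp [ev, oneZ, oneCochain]

/-- The cohomology algebra `H•(G, k) = ⨁ₙ Hⁿ(G, k)` with the cup product. -/
abbrev CohomologyAlgebra : Type _ := DirectSum ℕ (H k G)

/-- The homogeneous part of degree `n` of the cohomology algebra. -/
noncomputable def degreePart (n : ℕ) : Submodule k (CohomologyAlgebra k G) :=
  LinearMap.range (DirectSum.lof k ℕ (H k G) n)

end Algebra

end ContCoh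

/-! ## Quadratic algebras -/

namespace QuadAlg

open scoped TensorProduct

variable {k : Type*} [CommRing k]

/-- `A = ⨁ₙ 𝒜 n` and `B = ⨁ₙ ℬ n` are isomorphic as graded algebras. -/
def GradedIso {A B : Type*} [Ring A] [Algebra k A] [Ring B] [Algebra k B]
    (𝒜 : ℕ → Submodule k A) (ℬ : ℕ → Submodule k B) : Prop :=
  ∃ e : A ≃ₐ[k] B, ∀ n, (𝒜 n).map e.toLinearMap = ℬ n

section

variable {W : Type*} [AddCommGroup W] [Module k W]

/-- The inclusion `W ⊗ W → T•(W)`. -/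
noncomputable def tensorSq : W ⊗[k] W →ₗ[k] TensorAlgebra k W :=
  TensorProduct.lift
    ((LinearMap.mul k (TensorAlgebra k W)).compl₁₂ (TensorAlgebra.ι k) (TensorAlgebra.ι k))

theorem tensorSq_tmul (v w : W) :
    tensorSq (v ⊗ₜ[k] w) = TensorAlgebra.ι k v * TensorAlgebra.ι k w := rfl

/-- The relations `ω = 0` for `ω ∈ Ω`. -/
def Rel (Ω : Set (W ⊗[k] W)) (x y : TensorAlgebra k W) : Prop :=
  (∃ ω ∈ Ω, x = tensorSq ω) ∧ y = 0

/-- The quadratic algebra `Q(W, Ω) = T•(W) / (Ω)`. -/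
abbrev Q (Ω : Set (W ⊗[k] W)) : Type _ := RingQuot (Rel Ω)

/-- The homogeneous part of degree `n` of `Q(W, Ω)`: the image of `W^{⊗ n} ⊆ T•(W)`. -/
noncomputable def degree (Ω : Set (W ⊗[k] W)) (n : ℕ) : Submodule k (Q Ω) :=
  ((LinearMap.range (TensorAlgebra.ι k : W →ₗ[k] TensorAlgebra k W)) ^ n).map
    (RingQuot.mkAlgHom k (Rel Ω)).toLinearMap

end

/-- A graded algebra `A = ⨁ₙ 𝒜 n` is quadratic if it is isomorphic, as a graded algebra, to
`Q(A₁, Ω)` for some `Ω ⊆ A₁ ⊗ A₁`. -/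
def IsQuadratic {A : Type*} [Ring A] [Algebra k A] (𝒜 : ℕ → Submodule k A) : Prop :=
  ∃ Ω : Set (𝒜 1 ⊗[k] 𝒜 1), GradedIso 𝒜 (degree Ω)

end QuadAlg

/-- A topological group `G` is `H•`-quadratic (with respect to `p`) if its continuous
`𝔽_p`-cohomology algebra (with the cup product) is quadratic. -/
def IsHQuadratic (p : ℕ) (G : Type*) [Group G] [TopologicalSpace G] [ContinuousMul G] : Prop :=
  QuadAlg.IsQuadratic (ContCoh.degreePart (ZMod p) G)

/-! ## Free pro-`p` groups -/

/-- Normal subgroups of `p`-power index of the free group on `V`. -/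
def PPowNormal (p : ℕ) (V : Type*) : Type _ :=
  {N : Subgroup (FreeGroup V) // N.Normal ∧ ∃ m : ℕ, N.index = p ^ m}

namespace PPowNormal

variable {p : ℕ} {V : Type*} (N : PPowNormal p V)

instance : N.1.Normal := N.2.1

/-- The finite `p`-group `F / N`, with the discrete topology. -/
def Quot : Type _ := FreeGroup V ⧸ N.1

instance : Group N.Quot := inferInstanceAs (Group (FreeGroup V ⧸ N.1))

instance : TopologicalSpace N.Quot := ⊥

instance : DiscreteTopology N.Quot := ⟨rfl⟩

/-- The projection `F → F / N`. -/
def mk : FreeGroup V →* N.Quot := QuotientGroup.mk' N.1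

variable {N}

/-- The projection `F / N → F / M` for `N ≤ M`. -/
def map {M : PPowNormal p V} (h : N.1 ≤ M.1) : N.Quot →* M.Quot :=
  QuotientGroup.map N.1 M.1 (MonoidHom.id _) h

theorem pow_index (x : N.Quot) : x ^ N.1.index = 1 := pow_card_eq_one' (G := FreeGroup V ⧸ N.1)

theorem pow_index_of_le {M : PPowNormal p V} (h : N.1 ≤ M.1) (x : M.Quot) :
    x ^ N.1.index = 1 := by
  obtain ⟨c, hc⟩ := Subgroup.index_dvd_of_le h
  rw [hc, pow_mul, pow_index, one_pow]

variable [Fact p.Prime]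

/-- `p`-adic approximations beyond the precision `|F / N|` act in the same way on `F / N`. -/
theorem pow_appr (a : ℤ_[p]) (x : N.Quot) {n : ℕ} (hn : N.1.index ≤ n) :
    x ^ a.appr n = x ^ a.appr N.1.index := by
  obtain ⟨m, hm⟩ := N.2.2
  have hdvd : N.1.index ∣ a.appr n - a.appr N.1.index := by
    refine dvd_trans ?_ (PadicInt.dvd_appr_sub_appr a _ _ hn)
    nth_rw 1 [hm]
    refine pow_dvd_pow p ?_
    rw [hm]
    exact (Nat.lt_pow_self (Fact.out : p.Prime).one_lt).le
  obtain ⟨c, hc⟩ := hdvd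
  rw [← Nat.sub_add_cancel (PadicInt.appr_mono a hn), pow_add, hc, pow_mul, pow_index, one_pow,
    one_mul]

end PPowNormal

/-- The free pro-`p` group on a finite set `V`, i.e. the pro-`p` completion of the free group `F`
on `V`: the inverse limit of all quotients of `F` that are finite `p`-groups, with the topology
induced by the product of the discrete topologies. -/
def FreeProP (p : ℕ) (V : Type*) : Subgroup (∀ N : PPowNormal p V, N.Quot) where
  carrier := {x | ∀ (N M : PPowNormal p V) (h : N.1 ≤ M.1), PPowNormal.map h (x N) = x M}
  one_mem' _ _ _ := map_one _
  mul_mem' hx hy N M h := by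
    rw [Pi.mul_apply, map_mul, hx N M h, hy N M h, Pi.mul_apply]
  inv_mem' hx N M h := by
    rw [Pi.inv_apply, map_inv, hx N M h, Pi.inv_apply]

namespace FreeProP

variable {p : ℕ} {V : Type*}

/-- The free generators. -/
def of (v : V) : FreeProP p V := ⟨fun N => N.mk (FreeGroup.of v), fun _ _ _ => rfl⟩

variable [Fact p.Prime]

/-- The `p`-adic power `x ^ a`, for `a ∈ ℤ_p`; in a quotient `F / N` it is the power with exponent
any natural number that is congruent to `a` modulo `|F / N|`. -/
noncomputable def padicPow (x : FreeProP p V) (a : ℤ_[p]) : FreeProP p V :=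
  ⟨fun N => x.1 N ^ a.appr N.1.index, fun N M h => by
    have hN : N.1.index ≠ 0 := by
      obtain ⟨m, hm⟩ := N.2.2
      rw [hm]
      exact pow_ne_zero _ (Fact.out : p.Prime).ne_zero
    rw [map_pow, x.2 N M h]
    exact PPowNormal.pow_appr a _ (Nat.le_of_dvd (Nat.pos_of_ne_zero hN)
      (Subgroup.index_dvd_of_le h))⟩

/-- `x ^ a` is the limit of the powers `x ^ aₙ`, where `aₙ ∈ ℕ` and `aₙ ≡ a` modulo `pⁿ`. -/
theorem tendsto_padicPow (x : FreeProP p V) (a : ℤ_[p]) :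
    Filter.Tendsto (fun n => x ^ a.appr n) Filter.atTop (nhds (padicPow x a)) := by
  rw [tendsto_subtype_rng, tendsto_pi_nhds]
  intro N
  refine tendsto_const_nhds.congr' ?_
  filter_upwards [Filter.eventually_ge_atTop N.1.index] with n hn
  exact (PPowNormal.pow_appr a (x.1 N) hn).symm

end FreeProP

/-! ## `p`-graphs, `p`-RAAGs and `Λ•(𝒢ᵒᵖ)` -/

/-- The ideal of `ℤ_p` containing the labels of a `p`-graph: `pℤ_p` for `p ≠ 2` and `4ℤ_2` for
`p = 2`. -/
noncomputable def labelIdeal (p : ℕ) [Fact p.Prime] : Ideal ℤ_[p] :=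
  if p = 2 then Ideal.span {4} else Ideal.span {(p : ℤ_[p])}

/-- A `p`-graph with vertex set `V`: an oriented graph without loops and without circuits of
length `2`, together with a `p`-labelling of its edges. -/
structure PGraph (p : ℕ) [Fact p.Prime] (V : Type*) where
  /-- The set of (oriented) edges. -/
  edges : Set (V × V)
  no_loop : ∀ v, (v, v) ∉ edges
  no_two_circuit : ∀ v w, (v, w) ∈ edges → (w, v) ∉ edges
  /-- The labelling. -/
  label : edges → labelIdeal p × labelIdeal p

namespace PGraph

variable {p : ℕ} [Fact p.Prime] {V : Type*} (Γ : PGraph p V)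

/-- The relator `[o(e), t(e)] (o(e)^{f₁(e)} t(e)^{f₂(e)})⁻¹` of an edge `e`, where
`[x, y] = x⁻¹ y⁻¹ x y`. -/
noncomputable def relator (e : Γ.edges) : FreeProP p V :=
  let x : FreeProP p V := FreeProP.of e.1.1
  let y : FreeProP p V := FreeProP.of e.1.2
  (x⁻¹ * y⁻¹ * x * y) * (FreeProP.padicPow x (Γ.label e).1 * FreeProP.padicPow y (Γ.label e).2)⁻¹

/-- The closed normal subgroup generated by the relators. -/
noncomputable def relations : Subgroup (FreeProP p V) :=
  (Subgroup.normalClosure (Set.range Γ.relator)).topologicalClosure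

instance : Γ.relations.Normal := Subgroup.is_normal_topologicalClosure _

/-- The `p`-RAAG `G_Γ`: the pro-`p` group with generators the vertices of `Γ` and one relation
`[o(e), t(e)] = o(e)^{f₁(e)} t(e)^{f₂(e)}` for each edge `e`. -/
abbrev RAAG : Type _ := FreeProP p V ⧸ Γ.relations

open scoped TensorProduct

/-- The relations of `Λ•(𝒢ᵒᵖ)`: those of the exterior algebra on `𝔽_p⟨V⟩`, and `v ⊗ w = 0` for any
two vertices that are not joined by an edge of `𝒢`. -/
def exteriorOpRel : Set ((V →₀ ZMod p) ⊗[ZMod p] (V →₀ ZMod p)) :=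
  {ω | ∃ x : V →₀ ZMod p, ω = x ⊗ₜ x} ∪
    {ω | ∃ v w : V, (v, w) ∉ Γ.edges ∧ (w, v) ∉ Γ.edges ∧
      ω = Finsupp.single v 1 ⊗ₜ Finsupp.single w 1}

/-- The algebra `Λ•(𝒢ᵒᵖ)`, where `𝒢` is the underlying graph of `Γ`. -/
abbrev ExteriorOp : Type _ := QuadAlg.Q Γ.exteriorOpRel

/-- The homogeneous part of degree `n` of `Λ•(𝒢ᵒᵖ)`. -/
noncomputable def exteriorOpDegree (n : ℕ) : Submodule (ZMod p) Γ.ExteriorOp :=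
  QuadAlg.degree Γ.exteriorOpRel n

end PGraph

/-! A quadratic algebra is determined by its degree 1 part and the kernel of the multiplication `A₁
⊗ A₁ → A₂` (`IsQuadratic.gradedIso`), so only these two data of `H•(G_Γ, 𝔽_p)` have to be computed.

Commutators and `p`-th powers die in `𝔽_p`, so a continuous homomorphism `G_Γ → 𝔽_p` is an arbitrary
function on the vertices, and `H¹` is `𝔽_p⟨V⟩`. A tensor `t` in `𝔽_p⟨V⟩ ⊗ 𝔽_p⟨V⟩` is a bilinear form
`β` on `𝔽_p^V`, and its cup product is the pullback of the 2-cocycle `β` along `coord : G_Γ →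
𝔽_p^V`. It is a coboundary exactly when `coord` lifts to the central extension `BilinExt β`. This
extension has exponent dividing `p`, or 4 if `p = 2`, so the powers in the relators die there, and a
lift exists if and only if `β` is symmetric at each edge (`cupTensor_mem_B_iff`). The relations of
`Λ•(𝒢ᵒᵖ)` have this symmetry (`symmOnEdges_of_mem`), and every tensor that has it vanishes in
`Λ•(𝒢ᵒᵖ)` (`sqMap_ι_eq_zero`); so the two kernels agree. -/

/-! ### Quadratic algebras are determined by degrees 1 and 2 -/

namespace QuadAlg

open scoped TensorProduct

variable {k : Type*} [CommRing k] {W : Type*} [AddCommGroup W] [Module k W]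
  {A : Type*} [Ring A] [Algebra k A]

/-- The linear map `W ⊗ W → A`, `v ⊗ w ↦ f v * f w`. -/
noncomputable def sqMap (f : W →ₗ[k] A) : W ⊗[k] W →ₗ[k] A :=
  TensorProduct.lift ((LinearMap.mul k A).compl₁₂ f f)

theorem sqMap_tmul (f : W →ₗ[k] A) (v w : W) : sqMap f (v ⊗ₜ[k] w) = f v * f w := rfl

theorem algHom_tensorSq (F : TensorAlgebra k W →ₐ[k] A) (t : W ⊗[k] W) :
    F (tensorSq t) = sqMap (F.toLinearMap ∘ₗ TensorAlgebra.ι k) t := by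
  induction t with
  | zero => simp
  | tmul v w => simp [tensorSq_tmul, sqMap_tmul]
  | add x y hx hy => rw [map_add, map_add, hx, hy, map_add]

theorem algHom_sqMap {B : Type*} [Ring B] [Algebra k B] (F : A →ₐ[k] B) (f : W →ₗ[k] A)
    (t : W ⊗[k] W) : F (sqMap f t) = sqMap (F.toLinearMap ∘ₗ f) t := by
  induction t with
  | zero => simp
  | tmul v w => simp [sqMap_tmul]
  | add x y hx hy => rw [map_add, map_add, hx, hy, map_add]

theorem sqMap_comp {W' : Type*} [AddCommGroup W'] [Module k W'] (f : W →ₗ[k] A) (g : W' →ₗ[k] W)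
    (t : W' ⊗[k] W') : sqMap (f ∘ₗ g) t = sqMap f (TensorProduct.map g g t) := by
  induction t with
  | zero => simp
  | tmul v w => simp [sqMap_tmul]
  | add x y hx hy => rw [map_add, map_add, hx, hy, map_add]

namespace Q

variable (Ω : Set (W ⊗[k] W))

/-- The canonical map `W → Q(W, Ω)`. -/
noncomputable def ι : W →ₗ[k] Q Ω :=
  (RingQuot.mkAlgHom k (Rel Ω)).toLinearMap ∘ₗ TensorAlgebra.ι k

variable {Ω}

theorem sqMap_ι {ω : W ⊗[k] W} (h : ω ∈ Ω) : sqMap (ι Ω) ω = 0 := by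
  rw [ι, ← algHom_tensorSq, RingQuot.mkAlgHom_rel k (show Rel Ω _ 0 from ⟨⟨ω, h, rfl⟩, rfl⟩),
    map_zero]

/-- The universal property of `Q(W, Ω)`. -/
noncomputable def lift (f : W →ₗ[k] A) (h : ∀ ω ∈ Ω, sqMap f ω = 0) : Q Ω →ₐ[k] A :=
  RingQuot.liftAlgHom k ⟨TensorAlgebra.lift k f, by
    rintro _ _ ⟨⟨ω, hω, rfl⟩, rfl⟩
    rw [algHom_tensorSq, map_zero, ← h ω hω]
    congr 2
    ext
    simp⟩

theorem lift_ι (f : W →ₗ[k] A) (h : ∀ ω ∈ Ω, sqMap f ω = 0) (x : W) :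
    lift f h (ι Ω x) = f x := by
  simp [lift, ι]

theorem hom_ext {F F' : Q Ω →ₐ[k] A} (h : ∀ x, F (ι Ω x) = F' (ι Ω x)) : F = F' := by
  exact RingQuot.ringQuot_ext' k F F' (TensorAlgebra.hom_ext (LinearMap.ext h))

theorem degree_eq (n : ℕ) : degree Ω n = LinearMap.range (ι Ω) ^ n := by
  rw [degree, Submodule.map_pow, ι, LinearMap.range_comp]

theorem surjective_of_range_le (F : A →ₐ[k] Q Ω) (h : ∀ x, ι Ω x ∈ F.range) :
    Function.Surjective F := by
  intro y
  obtain ⟨x, rfl⟩ := RingQuot.mkAlgHom_surjective k _ y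
  change RingQuot.mkAlgHom k (Rel Ω) x ∈ F.range
  induction x using TensorAlgebra.induction with
  | algebraMap r => exact (AlgHom.commutes (RingQuot.mkAlgHom k (Rel Ω)) r).symm ▸ F.range.algebraMap_mem r
  | ι x => exact h x
  | mul a b ha hb => exact (map_mul (RingQuot.mkAlgHom k (Rel Ω)) a b).symm ▸ mul_mem ha hb
  | add a b ha hb => exact (map_add (RingQuot.mkAlgHom k (Rel Ω)) a b).symm ▸ add_mem ha hb

end Q

/-- A quadratic algebra is determined by its part of degree `1` and the multiplication map
`A₁ ⊗ A₁ → A₂`. -/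
theorem IsQuadratic.gradedIso {𝒜 : ℕ → Submodule k A} (hA : IsQuadratic 𝒜)
    {Ω : Set (W ⊗[k] W)} (h : W ≃ₗ[k] 𝒜 1)
    (hΩ : ∀ ω ∈ Ω, sqMap ((𝒜 1).subtype ∘ₗ h.toLinearMap) ω = 0)
    (hker : ∀ t, sqMap ((𝒜 1).subtype ∘ₗ h.toLinearMap) t = 0 → sqMap (Q.ι Ω) t = 0) :
    GradedIso 𝒜 (degree Ω) := by
  obtain ⟨Ω', e, he⟩ := hA
  have hιe : ∀ x, e.symm (Q.ι Ω' x) ∈ 𝒜 1 := fun x => by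
    have : Q.ι Ω' x ∈ (𝒜 1).map e.toLinearMap := by
      rw [he, Q.degree_eq, pow_one]
      exact ⟨x, rfl⟩
    obtain ⟨y, hy, hyx⟩ := this
    rw [← hyx]
    simpa using hy
  -- The isomorphism `e` need not restrict to the canonical map on `𝒜 1`; `g` measures the
  -- discrepancy. Only its surjectivity is used.
  let g : 𝒜 1 →ₗ[k] 𝒜 1 := (e.symm.toLinearMap ∘ₗ Q.ι Ω').codRestrict _ hιe
  have hg : (𝒜 1).subtype ∘ₗ g = e.symm.toLinearMap ∘ₗ Q.ι Ω' := rfl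
  have hgs : Function.Surjective g := fun y => by
    have : e y ∈ degree Ω' 1 := by
      rw [← he]
      exact ⟨y, y.2, rfl⟩
    rw [Q.degree_eq, pow_one] at this
    obtain ⟨x, hx⟩ := this
    refine ⟨x, Subtype.ext ?_⟩
    change e.symm (Q.ι Ω' x) = y
    rw [hx, AlgEquiv.symm_apply_apply]
  let φ : Q Ω →ₐ[k] A := Q.lift _ hΩ
  -- The relations in `Ω'` hold in `A`, hence by `hker` in `Q Ω` as well. Since `φ ∘ ψ = e⁻¹`, the
  -- map `ψ` is injective; it is surjective because it hits the generators.
  let ψ : Q Ω' →ₐ[k] Q Ω := Q.lift (Q.ι Ω ∘ₗ h.symm.toLinearMap ∘ₗ g) (by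
    intro ω hω
    rw [sqMap_comp]
    refine hker _ ?_
    rw [← sqMap_comp]
    have : ((𝒜 1).subtype ∘ₗ h.toLinearMap) ∘ₗ h.symm.toLinearMap ∘ₗ g =
        e.symm.toAlgHom.toLinearMap ∘ₗ Q.ι Ω' := by
      ext x
      simpa using LinearMap.congr_fun hg x
    rw [this, ← algHom_sqMap, Q.sqMap_ι hω, map_zero])
  have hφψ : φ.comp ψ = e.symm.toAlgHom := Q.hom_ext fun x => by
    simp only [AlgHom.comp_apply, φ, ψ, Q.lift_ι, LinearMap.comp_apply]
    simpa using LinearMap.congr_fun hg x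
  have hφψ' : ∀ x, φ (ψ x) = e.symm x := DFunLike.congr_fun hφψ
  have hψ : Function.Bijective ψ := by
    constructor
    · intro x y hxy
      apply e.symm.injective
      rw [← hφψ', ← hφψ', hxy]
    · refine Q.surjective_of_range_le ψ fun x => ?_
      obtain ⟨y, hy⟩ := hgs (h x)
      refine ⟨Q.ι Ω' y, ?_⟩
      change ψ _ = _
      simp only [ψ, Q.lift_ι, LinearMap.comp_apply, hy]
      simp
  let E : A ≃ₐ[k] Q Ω := e.trans (AlgEquiv.ofBijective ψ hψ)
  have hEφ : ∀ x, E (φ x) = x := fun x => by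
    obtain ⟨y, rfl⟩ := hψ.2 x
    simp [E, hφψ']
  -- Being generated in degree 1 is inherited from `Q Ω'`; it reduces the compatibility of `E` with
  -- the gradings to degree 1.
  have hpow : ∀ n, 𝒜 n = 𝒜 1 ^ n := fun n => by
    apply Submodule.map_injective_of_injective (f := e.toLinearMap) e.injective
    rw [he, Q.degree_eq]
    change _ = Submodule.map e.toAlgHom.toLinearMap (𝒜 1 ^ n)
    rw [Submodule.map_pow]
    congr 1
    rw [← pow_one (LinearMap.range _), ← Q.degree_eq, ← he]
    rfl
  refine ⟨E, fun n => ?_⟩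
  rw [hpow, Q.degree_eq]
  change Submodule.map E.toAlgHom.toLinearMap (𝒜 1 ^ n) = _
  rw [Submodule.map_pow]
  congr 1
  have hE : ∀ w, E (h w) = Q.ι Ω w := fun w => by
    rw [← hEφ (Q.ι Ω w)]
    congr 1
    simp [φ, Q.lift_ι]
  ext y
  constructor
  · rintro ⟨x, hx, rfl⟩
    refine ⟨h.symm ⟨x, hx⟩, ?_⟩
    rw [← hE]
    simp
  · rintro ⟨w, rfl⟩
    exact ⟨h w, (h w).2, hE w⟩

end QuadAlg

/-! ### Homomorphisms from free pro-`p` groups to finite `p`-groups -/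

namespace FreeProP

variable {p : ℕ} {V : Type*}

/-- The embedding of the free group. -/
def ofFree : FreeGroup V →* FreeProP p V where
  toFun g := ⟨fun N => N.mk g, fun _ _ _ => rfl⟩
  map_one' := Subtype.ext <| funext fun N => map_one N.mk
  map_mul' g h := Subtype.ext <| funext fun N => map_mul N.mk g h

variable [Fact p.Prime]

/-- The kernel of a homomorphism to a finite `p`-group. -/
def kerPPow {P : Type*} [Group P] [Finite P] (hP : IsPGroup p P) (f : FreeGroup V →* P) :
    PPowNormal p V :=
  ⟨f.ker, inferInstance, by
    rw [Subgroup.index_ker]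
    exact (IsPGroup.iff_card.1 (hP.to_subgroup f.range))⟩

theorem finite_quot (N : PPowNormal p V) : Finite N.Quot := by
  obtain ⟨m, hm⟩ := N.2.2
  refine Nat.finite_of_card_ne_zero ?_
  change N.1.index ≠ 0
  rw [hm]
  exact pow_ne_zero _ (Fact.out : p.Prime).ne_zero

/-- Finitely many normal subgroups of `p`-power index contain a common one. -/
theorem exists_le (s : Finset (PPowNormal p V)) : ∃ M : PPowNormal p V, ∀ N ∈ s, M.1 ≤ N.1 := by
  classical
  have : ∀ N : s, Finite N.1.Quot := fun N => finite_quot N.1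
  have hP : IsPGroup p (∀ N : s, N.1.Quot) := fun x => by
    choose m hm using fun N : s => N.1.2.2
    refine ⟨∑ N, m N, funext fun N => ?_⟩
    rw [← Finset.add_sum_erase _ _ (Finset.mem_univ N), pow_add, pow_mul, ← hm, Pi.pow_apply,
      Pi.pow_apply, N.1.pow_index, one_pow, Pi.one_apply]
  refine ⟨kerPPow hP (MonoidHom.pi fun N : s => N.1.mk), fun N hN g hg => ?_⟩
  exact (QuotientGroup.eq_one_iff g).1 (congrFun (MonoidHom.mem_ker.1 hg) ⟨N, hN⟩)

/-- A basic neighbourhood constrains finitely many coordinates. By `exists_le` all of them are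
determined by the coordinate at a single `M`, and every element of `F / M` comes from `F`. -/
theorem denseRange_ofFree : DenseRange (ofFree (p := p) (V := V)) := by
  intro x
  rw [mem_closure_iff_nhds]
  intro t ht
  rw [nhds_subtype_eq_comap, Filter.mem_comap] at ht
  obtain ⟨u, hu, hut⟩ := ht
  rw [nhds_pi, Filter.mem_pi] at hu
  obtain ⟨I, hI, t', ht', hsub⟩ := hu
  obtain ⟨M, hM⟩ := exists_le hI.toFinset
  obtain ⟨g, hg⟩ := QuotientGroup.mk_surjective (x.1 M)
  refine ⟨ofFree g, hut (hsub fun N hN => ?_), ⟨g, rfl⟩⟩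
  have : N.mk g = x.1 N := by
    rw [← x.2 M N (hM N (hI.mem_toFinset.2 hN)), ← hg]
    rfl
  change N.mk g ∈ t' N
  rw [this]
  exact mem_of_mem_nhds (ht' N)

/-- The universal property of free pro-`p` groups with respect to finite `p`-groups. -/
theorem exists_lift {P : Type*} [Group P] [Finite P] [TopologicalSpace P] (hP : IsPGroup p P)
    (f : V → P) : ∃ θ : FreeProP p V →* P, Continuous θ ∧ ∀ v, θ (of v) = f v := by
  let F := FreeGroup.lift f
  let N := kerPPow hP F
  let κ : N.Quot →* P := QuotientGroup.kerLift F
  -- The lift reads the single coordinate at the kernel of `F` and embeds that quotient into `P`.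
  refine ⟨κ.comp ((Pi.evalMonoidHom _ N).comp (FreeProP p V).subtype), ?_, fun v => ?_⟩
  · exact (continuous_of_discreteTopology (f := κ)).comp
      ((continuous_apply N).comp continuous_subtype_val)
  · exact FreeGroup.lift_apply_of

variable {P : Type*} [Group P] [TopologicalSpace P]

theorem hom_ext [T2Space P] {θ θ' : FreeProP p V →* P} (h : Continuous θ) (h' : Continuous θ')
    (hv : ∀ v, θ (of v) = θ' (of v)) : θ = θ' := by
  refine DFunLike.coe_injective (denseRange_ofFree.equalizer h h' (funext fun g => ?_))
  have : θ.comp ofFree = θ'.comp ofFree := FreeGroup.ext_hom _ _ hv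
  exact DFunLike.congr_fun this g

/-- By continuity, the image of `x ^ a` is the eventual value of the powers `θ x ^ a.appr m`, whose
exponents are divisible by `p ^ n` once `m ≥ n`. -/
theorem map_padicPow [DiscreteTopology P] {θ : FreeProP p V →* P} (h : Continuous θ)
    {n : ℕ} (hn : ∀ x : P, x ^ p ^ n = 1) (x : FreeProP p V) {a : ℤ_[p]}
    (ha : a ∈ Ideal.span {(p : ℤ_[p]) ^ n}) : θ (padicPow x a) = 1 := by
  have h1 := (h.tendsto _).comp (tendsto_padicPow x a)
  rw [nhds_discrete, Filter.tendsto_pure] at h1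
  obtain ⟨m, hm, hnm⟩ := (h1.and (Filter.eventually_ge_atTop n)).exists
  have hdvd : p ^ n ∣ a.appr m := by
    have h2 := Ideal.sub_mem _ ha (Ideal.span_singleton_le_span_singleton.2
      (pow_dvd_pow _ hnm) (PadicInt.appr_spec m a))
    rw [sub_sub_cancel, ← PadicInt.ker_toZModPow, RingHom.mem_ker, map_natCast,
      ZMod.natCast_eq_zero_iff] at h2
    exact h2
  obtain ⟨c, hc⟩ := hdvd
  rw [← hm, Function.comp_apply, map_pow, hc, pow_mul, hn, one_pow]

end FreeProP

/-! ### Homomorphisms from `G_Γ` to groups of small exponent -/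

/-- `labelIdeal p` is generated by `p ^ labelExp p`. -/
def labelExp (p : ℕ) : ℕ := if p = 2 then 2 else 1

theorem labelIdeal_eq (p : ℕ) [Fact p.Prime] :
    labelIdeal p = Ideal.span {(p : ℤ_[p]) ^ labelExp p} := by
  unfold labelIdeal labelExp
  split_ifs with h
  · subst h
    norm_num
  · rw [pow_one]

namespace PGraph

variable {p : ℕ} [Fact p.Prime] {V : Type*} (Γ : PGraph p V)
  {P : Type*} [Group P] [TopologicalSpace P] [DiscreteTopology P]

/-- The labels are divisible by `p ^ labelExp p`, so the powers in the relator become trivial and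
only the commutator survives. -/
theorem map_relator_eq_one_iff {θ : FreeProP p V →* P} (h : Continuous θ)
    (hn : ∀ x : P, x ^ p ^ labelExp p = 1) (e : Γ.edges) :
    θ (Γ.relator e) = 1 ↔
      θ (FreeProP.of e.1.1) * θ (FreeProP.of e.1.2) = θ (FreeProP.of e.1.2) * θ (FreeProP.of e.1.1) := by
  have h1 := FreeProP.map_padicPow h hn (FreeProP.of e.1.1) ((labelIdeal_eq p).le (Γ.label e).1.2)
  have h2 := FreeProP.map_padicPow h hn (FreeProP.of e.1.2) ((labelIdeal_eq p).le (Γ.label e).2.2)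
  simp only [relator, map_mul, map_inv, h1, h2, mul_one, inv_one]
  rw [mul_assoc, mul_assoc, inv_mul_eq_one, eq_inv_mul_iff_mul_eq, eq_comm]

variable {Γ}

/-- The vertices as elements of the `p`-RAAG. -/
noncomputable def gen (v : V) : Γ.RAAG := QuotientGroup.mk (FreeProP.of v)

theorem gen_comm {θ : Γ.RAAG →* P} (h : Continuous θ) (hn : ∀ x : P, x ^ p ^ labelExp p = 1)
    {v w : V} (he : (v, w) ∈ Γ.edges) : θ (gen v) * θ (gen w) = θ (gen w) * θ (gen v) := by
  refine (Γ.map_relator_eq_one_iff (θ := θ.comp (QuotientGroup.mk' Γ.relations))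
    (h.comp QuotientGroup.continuous_mk) hn ⟨_, he⟩).1 ?_
  have : Γ.relator ⟨_, he⟩ ∈ Γ.relations :=
    Subgroup.le_topologicalClosure _ (Subgroup.subset_normalClosure ⟨_, rfl⟩)
  rw [MonoidHom.comp_apply, QuotientGroup.mk'_apply, (QuotientGroup.eq_one_iff _).2 this, map_one]

theorem hom_ext {θ θ' : Γ.RAAG →* P} (h : Continuous θ) (h' : Continuous θ')
    (hv : ∀ v, θ (gen v) = θ' (gen v)) : θ = θ' := by
  refine QuotientGroup.monoidHom_ext _ ?_
  exact FreeProP.hom_ext (h.comp QuotientGroup.continuous_mk)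
    (h'.comp QuotientGroup.continuous_mk) hv

/-- As `P` is discrete, the kernel of a continuous lift from the free pro-`p` group is closed; it
contains all relations once it contains the relators. -/
theorem exists_hom [Finite P] (hn : ∀ x : P, x ^ p ^ labelExp p = 1) (f : V → P)
    (hf : ∀ v w, (v, w) ∈ Γ.edges → f v * f w = f w * f v) :
    ∃ θ : Γ.RAAG →* P, Continuous θ ∧ ∀ v, θ (gen v) = f v := by
  obtain ⟨θ, hθ, hv⟩ := FreeProP.exists_lift (p := p) (fun x => ⟨_, hn x⟩) f
  have hker : Γ.relations ≤ θ.ker := by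
    refine Subgroup.topologicalClosure_minimal _ (Subgroup.normalClosure_le_normal ?_) ?_
    · rintro _ ⟨e, rfl⟩
      refine (Γ.map_relator_eq_one_iff hθ hn e).2 ?_
      rw [hv, hv]
      exact hf _ _ e.2
    · exact (isClosed_discrete {(1 : P)}).preimage hθ
  exact ⟨QuotientGroup.lift _ θ hker, hθ.quotient_lift _, hv⟩

end PGraph

/-! ### Central extensions given by bilinear forms -/

/-- The central extension of the additive group of `E` by the additive group of `k` that is given
by the bilinear map `β`, seen as a `2`-cocycle. -/
@[ext]
structure BilinExt {k E : Type*} [CommRing k] [AddCommGroup E] [Module k E]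
    (β : E →ₗ[k] E →ₗ[k] k) where
  /-- The central coordinate. -/
  c : k
  /-- The image in `E`. -/
  x : E

namespace BilinExt

variable {k E : Type*} [CommRing k] [AddCommGroup E] [Module k E] {β : E →ₗ[k] E →ₗ[k] k}

instance : Mul (BilinExt β) := ⟨fun a b => ⟨a.c + b.c + β a.x b.x, a.x + b.x⟩⟩

instance : One (BilinExt β) := ⟨⟨0, 0⟩⟩

instance : Inv (BilinExt β) := ⟨fun a => ⟨-a.c + β a.x a.x, -a.x⟩⟩

theorem mul_def (a b : BilinExt β) : a * b = ⟨a.c + b.c + β a.x b.x, a.x + b.x⟩ := rfl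

theorem one_def : (1 : BilinExt β) = ⟨0, 0⟩ := rfl

theorem inv_def (a : BilinExt β) : a⁻¹ = ⟨-a.c + β a.x a.x, -a.x⟩ := rfl

instance : Group (BilinExt β) := Group.ofLeftAxioms
  (fun a b c => by
    simp only [mul_def, map_add, LinearMap.add_apply, mk.injEq]
    exact ⟨by ring, add_assoc _ _ _⟩)
  (fun a => by simp [mul_def, one_def])
  (fun a => by simp [mul_def, one_def, inv_def])

instance : TopologicalSpace (BilinExt β) := ⊥

instance : DiscreteTopology (BilinExt β) := ⟨rfl⟩

instance [Finite k] [Finite E] : Finite (BilinExt β) :=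
  Finite.of_injective (fun a : BilinExt β => (a.c, a.x)) fun a b h => by
    rw [Prod.mk.injEq] at h
    exact BilinExt.ext h.1 h.2

theorem mul_comm_iff (a b : BilinExt β) : a * b = b * a ↔ β a.x b.x = β b.x a.x := by
  rw [mul_def, mul_def, mk.injEq, add_comm b.x, add_comm b.c, add_right_inj]
  simp

/-- Each of the `n.choose 2` pairs of factors contributes one term `β x x`. -/
theorem pow_eq (a : BilinExt β) (n : ℕ) : a ^ n = ⟨n • a.c + n.choose 2 • β a.x a.x, n • a.x⟩ := by
  induction n with
  | zero => simp [one_def]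
  | succ n ih =>
    rw [pow_succ, ih, mul_def, mk.injEq, succ_nsmul a.x, Nat.choose_succ_succ, Nat.choose_one_right]
    refine ⟨?_, rfl⟩
    simp
    ring

/-- By `pow_eq`, `p` must divide both the exponent `m` and `m.choose 2`. For odd `p`, `m = p` works;
for `p = 2`, `2.choose 2 = 1` is odd but `4.choose 2 = 6` is even. This is why the labels lie in
`4ℤ_2`. -/
theorem pow_labelExp {p : ℕ} [Fact p.Prime] {E : Type*} [AddCommGroup E] [Module (ZMod p) E]
    {β : E →ₗ[ZMod p] E →ₗ[ZMod p] ZMod p} (a : BilinExt β) : a ^ p ^ labelExp p = 1 := by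
  have hp : p.Prime := Fact.out
  have key : ∀ {M : Type _} [AddCommGroup M] [Module (ZMod p) M] (m : ℕ) (y : M), p ∣ m →
      m • y = 0 := by
    intro M _ _ m y h
    rw [← Nat.cast_smul_eq_nsmul (ZMod p), (ZMod.natCast_eq_zero_iff _ _).2 h, zero_smul]
  have h1 : p ∣ p ^ labelExp p := dvd_pow_self p (by unfold labelExp; split_ifs <;> simp)
  have h2 : p ∣ (p ^ labelExp p).choose 2 := by
    unfold labelExp
    split_ifs with h
    · subst h
      decide
    · rw [pow_one]
      exact hp.dvd_choose_self two_ne_zero (lt_of_le_of_ne hp.two_le (Ne.symm h))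
  rw [pow_eq, one_def, mk.injEq, nsmul_eq_mul, nsmul_eq_mul, (ZMod.natCast_eq_zero_iff _ _).2 h1,
    (ZMod.natCast_eq_zero_iff _ _).2 h2]
  exact ⟨by simp, key _ _ h1⟩

end BilinExt

/-! ### Cocycles and coboundaries in low degree -/

namespace ContCoh

variable {k : Type*} [CommRing k] {G : Type*} [Group G] [TopologicalSpace G] [ContinuousMul G]

theorem ev_d_one (a : Cochain k G 1) (s : ℕ → G) : ev (d k G 1 a) s =
    a (fun _ => s 1) - a (fun _ => s 0 * s 1) + a fun _ => s 0 := by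
  rw [ev_d, Finset.sum_range_succ, Finset.sum_range_succ, Finset.sum_range_one]
  simp only [ev, face, Fin.val_eq_zero]
  simp
  ring

theorem mem_Z_one_iff {a : Cochain k G 1} :
    a ∈ Z k G 1 ↔ ∀ g h, a (fun _ => g * h) = a (fun _ => g) + a fun _ => h := by
  constructor
  · intro ha g h
    -- Only the entries 0 and 1 are read; the value `h` at later indices is a filler.
    have := ev_d_one a fun n => if n = 0 then g else h
    rw [LinearMap.mem_ker.1 ha] at this
    simp only [ev, LocallyConstant.coe_zero, Pi.zero_apply] at this
    simp at this
    linear_combination this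
  · intro h
    refine ev_ext fun s => ?_
    rw [ev_d_one, h]
    simp [ev]

theorem mem_B_two_iff {c : Cochain k G (1 + 1)} :
    c ∈ B k G (1 + 1) ↔ ∃ φ : Cochain k G 1, ∀ s : ℕ → G,
      ev c s = φ (fun _ => s 1) - φ (fun _ => s 0 * s 1) + φ fun _ => s 0 := by
  constructor
  · rintro ⟨φ, rfl⟩
    exact ⟨φ, ev_d_one φ⟩
  · rintro ⟨φ, h⟩
    exact mem_B_of_ev rfl φ fun s => (h s).trans (ev_d_one φ s).symm

end ContCoh

/-! ### Tensors as bilinear forms -/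

open scoped TensorProduct

section BilinForm

variable {k V : Type*} [CommRing k]

/-- The bilinear form on `V → k` that is given by a tensor in `k⟨V⟩ ⊗ k⟨V⟩`. -/
noncomputable def tensorForm :
    (V →₀ k) ⊗[k] (V →₀ k) →ₗ[k] (V → k) →ₗ[k] (V → k) →ₗ[k] k :=
  let D : (V →₀ k) →ₗ[k] (V → k) →ₗ[k] k :=
    Finsupp.linearCombination k fun v => LinearMap.proj v
  TensorProduct.lift (LinearMap.mk₂ k (fun x y => (LinearMap.mul k k).compl₁₂ (D x) (D y))
    (fun _ _ _ => by ext; simp) (fun _ _ _ => by ext; simp [mul_assoc])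
    (fun _ _ _ => by ext; simp [mul_add]) (fun _ _ _ => by ext; simp; ring))

theorem tensorForm_tmul (x y : V →₀ k) (u v : V → k) :
    tensorForm (x ⊗ₜ y) u v = Finsupp.linearCombination k u x * Finsupp.linearCombination k v y := by
  have h : ∀ (x : V →₀ k) (u : V → k),
      Finsupp.linearCombination k (fun v => (LinearMap.proj v : (V → k) →ₗ[k] k)) x u =
        Finsupp.linearCombination k u x := fun x u => by
    simp [Finsupp.linearCombination_apply, Finsupp.sum]
  rw [← h, ← h]
  rfl

variable [DecidableEq V]

theorem linearCombination_single_one (v : V) (x : V →₀ k) :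
    Finsupp.linearCombination k (Pi.single v 1 : V → k) x = x v := by
  rw [Finsupp.linearCombination_apply, Finsupp.sum, Finset.sum_eq_single v]
  · simp
  · intro w _ hw
    simp [hw]
  · intro hv
    simp [Finsupp.notMem_support_iff.1 hv]

theorem tensorForm_tmul_single (x y : V →₀ k) (v w : V) :
    tensorForm (x ⊗ₜ y) (Pi.single v 1) (Pi.single w 1) = x v * y w := by
  rw [tensorForm_tmul, linearCombination_single_one, linearCombination_single_one]

/-- The values of the form at coordinate vectors are the coefficients of `t` in the basis `v ⊗ w`,
so no information is lost in passing to forms. -/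
theorem eq_sum_tensorForm [Fintype V] (t : (V →₀ k) ⊗[k] (V →₀ k)) :
    t = ∑ v, ∑ w, tensorForm t (Pi.single v 1) (Pi.single w 1) •
      (Finsupp.single v 1 ⊗ₜ[k] Finsupp.single w 1) := by
  induction t with
  | zero => simp
  | tmul x y =>
    simp only [tensorForm_tmul_single, ← TensorProduct.smul_tmul_smul, ← TensorProduct.tmul_sum,
      ← TensorProduct.sum_tmul]
    congr 1 <;> simp
  | add x y hx hy =>
    simp only [map_add, LinearMap.add_apply, add_smul, Finset.sum_add_distrib, ← hx, ← hy]

end BilinForm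

/-! ### Tensors symmetric at the edges -/

namespace PGraph

open ContCoh QuadAlg

variable {p : ℕ} [Fact p.Prime] {V : Type*} (Γ : PGraph p V)

/-- The tensor `t` is symmetric at the edges of `Γ`. -/
def SymmOnEdges [DecidableEq V] (t : (V →₀ ZMod p) ⊗[ZMod p] (V →₀ ZMod p)) : Prop :=
  ∀ v w, (v, w) ∈ Γ.edges → tensorForm t (Pi.single v 1) (Pi.single w 1) =
    tensorForm t (Pi.single w 1) (Pi.single v 1)

variable {Γ} in
-- The form of `x ⊗ x` is symmetric everywhere. That of `v' ⊗ w'` has its only nonzero coefficient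
-- at `(v', w')`, which is not an edge in either orientation.
theorem symmOnEdges_of_mem [DecidableEq V] {ω : (V →₀ ZMod p) ⊗[ZMod p] (V →₀ ZMod p)}
    (h : ω ∈ Γ.exteriorOpRel) : Γ.SymmOnEdges ω := by
  intro v w hvw
  rcases h with ⟨x, rfl⟩ | ⟨v', w', h1, h2, rfl⟩
  · rw [tensorForm_tmul_single, tensorForm_tmul_single, mul_comm]
  · rw [tensorForm_tmul_single, tensorForm_tmul_single]
    by_cases hv : v' = v ∧ w' = w
    · exact absurd (hv.1 ▸ hv.2 ▸ hvw) h1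
    · by_cases hw : v' = w ∧ w' = v
      · exact absurd (hw.1 ▸ hw.2 ▸ hvw) h2
      · simp only [Finsupp.single_apply]
        simp only [not_and] at *
        split_ifs <;> simp_all

variable {Γ} in
/-- In `Λ•(𝒢ᵒᵖ)` the tensors that are symmetric at the edges vanish. -/
theorem sqMap_ι_eq_zero [Finite V] [DecidableEq V]
    {t : (V →₀ ZMod p) ⊗[ZMod p] (V →₀ ZMod p)}
    (ht : Γ.SymmOnEdges t) : sqMap (Q.ι Γ.exteriorOpRel) t = 0 := by
  have := Fintype.ofFinite V
  let b : V → V → Γ.ExteriorOp := fun v w =>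
    Q.ι Γ.exteriorOpRel (Finsupp.single v 1) * Q.ι Γ.exteriorOpRel (Finsupp.single w 1)
  have hsq : ∀ x, Q.ι Γ.exteriorOpRel x * Q.ι Γ.exteriorOpRel x = 0 := fun x =>
    Q.sqMap_ι (ω := x ⊗ₜ x) (Or.inl ⟨x, rfl⟩)
  have hnon : ∀ v w, (v, w) ∉ Γ.edges → (w, v) ∉ Γ.edges → b v w = 0 := fun v w h1 h2 =>
    Q.sqMap_ι (ω := Finsupp.single v 1 ⊗ₜ Finsupp.single w 1) (Or.inr ⟨v, w, h1, h2, rfl⟩)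
  have hswap : ∀ v w, b v w + b w v = 0 := fun v w => by
    have := hsq (Finsupp.single v 1 + Finsupp.single w 1)
    rw [map_add, mul_add, add_mul, add_mul, hsq, hsq, zero_add, add_zero, add_comm] at this
    exact this
  rw [eq_sum_tensorForm t]
  simp only [map_sum, map_smul, sqMap_tmul]
  rw [← Finset.sum_product']
  -- The terms at `(v, w)` and `(w, v)` cancel: for an edge the coefficients agree and the products
  -- are opposite, otherwise both products vanish. Diagonal terms are squares, hence zero, without
  -- dividing by 2.
  refine Finset.sum_involution (fun x _ => x.swap) ?_ ?_ (fun _ _ => Finset.mem_univ _)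
    (fun _ _ => Prod.swap_swap _)
  · rintro ⟨v, w⟩ -
    change _ • b v w + _ • b w v = 0
    by_cases h : (v, w) ∈ Γ.edges ∨ (w, v) ∈ Γ.edges
    · have : tensorForm t (Pi.single v 1) (Pi.single w 1) =
          tensorForm t (Pi.single w 1) (Pi.single v 1) :=
        h.elim (ht v w) fun h => (ht w v h).symm
      dsimp only [Prod.swap]
      rw [this, ← smul_add, hswap, smul_zero]
    · rw [not_or] at h
      rw [hnon v w h.1 h.2, hnon w v h.2 h.1, smul_zero, smul_zero, add_zero]
  · rintro ⟨v, w⟩ - h h'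
    obtain rfl : w = v := congrArg Prod.fst h'
    exact h (by rw [hsq, smul_zero])

/-! ### The first cohomology group of `G_Γ` -/

/-- Evaluation of a `1`-cocycle on the generators. -/
noncomputable def evalGen : Z (ZMod p) Γ.RAAG 1 →ₗ[ZMod p] V → ZMod p where
  toFun a v := a.1 fun _ => gen v
  map_add' _ _ := rfl
  map_smul' _ _ := rfl

/-- A 1-cocycle is a continuous homomorphism to `𝔽_p`, and the vertices generate topologically. The
extension by the zero form serves as a multiplicative home for `𝔽_p`, with second coordinate 0, so
that `hom_ext` applies. -/
theorem evalGen_injective : Function.Injective Γ.evalGen := by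
  have key : ∀ a : Z (ZMod p) Γ.RAAG 1, ∃ θ : Γ.RAAG →* BilinExt
      (0 : ZMod p →ₗ[ZMod p] ZMod p →ₗ[ZMod p] ZMod p), Continuous θ ∧
      ∀ g, θ g = ⟨a.1 fun _ => g, 0⟩ := fun a =>
    ⟨MonoidHom.mk' (fun g => ⟨a.1 fun _ => g, 0⟩) fun g h => by
      simp [BilinExt.mul_def, mem_Z_one_iff.1 a.2], by
      refine (a.1.isLocallyConstant.comp fun r => BilinExt.mk r 0).continuous.comp
        (continuous_pi fun _ => continuous_id), fun _ => rfl⟩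
  intro a b hab
  obtain ⟨θ, hθ, ha⟩ := key a
  obtain ⟨θ', hθ', hb⟩ := key b
  have : θ = θ' := hom_ext hθ hθ' fun v => by
    rw [ha, hb]
    congr 1
    exact congrFun hab v
  refine Subtype.ext (LocallyConstant.ext fun g => ?_)
  have h2 := DFunLike.congr_fun this (g 0)
  rw [ha, hb] at h2
  have hg : g = fun _ => g 0 := funext fun i => by rw [Subsingleton.elim i 0]
  rw [hg]
  exact congrArg BilinExt.c h2

/-- Functions on the target of a continuous homomorphism give `1`-cochains. -/
theorem exists_cochain {E : Type*} [AddCommGroup E] [Module (ZMod p) E]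
    {β : E →ₗ[ZMod p] E →ₗ[ZMod p] ZMod p} {θ : Γ.RAAG →* BilinExt β} (h : Continuous θ)
    (f : BilinExt β → ZMod p) :
    ∃ a : Cochain (ZMod p) Γ.RAAG 1, ∀ g, a g = f (θ (g 0)) :=
  ⟨⟨fun g => f (θ (g 0)), ((IsLocallyConstant.iff_continuous (fun g : Fin 1 → Γ.RAAG => θ (g 0))).2
    (h.comp (continuous_apply 0))).comp f⟩, fun _ => rfl⟩

/-- The extension by the zero form is commutative, so the edges impose no condition on the values at
the vertices. -/
theorem evalGen_surjective : Function.Surjective Γ.evalGen := by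
  intro f
  obtain ⟨θ, hθ, hv⟩ := exists_hom (Γ := Γ) BilinExt.pow_labelExp (fun v =>
    (⟨f v, 0⟩ : BilinExt (0 : ZMod p →ₗ[ZMod p] ZMod p →ₗ[ZMod p] ZMod p))) (fun v w _ => by
      simp [BilinExt.mul_comm_iff])
  obtain ⟨a, ha⟩ := Γ.exists_cochain hθ BilinExt.c
  refine ⟨⟨a, mem_Z_one_iff.2 fun g h => ?_⟩, funext fun v => ?_⟩
  · rw [ha, ha, ha, map_mul]
    simp [BilinExt.mul_def]
  · change a _ = _
    rw [ha, hv]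

/-- `1`-cocycles correspond to functions on the vertices. -/
noncomputable def cocycleEquiv [Finite V] : (V →₀ ZMod p) ≃ₗ[ZMod p] Z (ZMod p) Γ.RAAG 1 :=
  (Finsupp.linearEquivFunOnFinite (ZMod p) (ZMod p) V).trans
    (LinearEquiv.ofBijective Γ.evalGen ⟨Γ.evalGen_injective, Γ.evalGen_surjective⟩).symm

theorem cocycleEquiv_gen [Finite V] (x : V →₀ ZMod p) (v : V) :
    (Γ.cocycleEquiv x).1 (fun _ => gen v) = x v :=
  congrFun ((LinearEquiv.ofBijective Γ.evalGen
    ⟨Γ.evalGen_injective, Γ.evalGen_surjective⟩).apply_symm_apply x) v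

/-- The coordinates of the image of `g` in the Frattini quotient. -/
noncomputable def coord [Finite V] (g : Γ.RAAG) (v : V) : ZMod p :=
  (Γ.cocycleEquiv (Finsupp.single v 1)).1 fun _ => g

theorem coord_gen [Finite V] [DecidableEq V] (v : V) : Γ.coord (gen v) = Pi.single v 1 := by
  ext w
  rw [coord, cocycleEquiv_gen, Finsupp.single_apply, Pi.single_apply]

theorem coord_mul [Finite V] (g h : Γ.RAAG) : Γ.coord (g * h) = Γ.coord g + Γ.coord h :=
  funext fun v => mem_Z_one_iff.1 (Γ.cocycleEquiv (Finsupp.single v 1)).2 g h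

theorem cocycleEquiv_apply [Finite V] (x : V →₀ ZMod p) (g : Γ.RAAG) :
    (Γ.cocycleEquiv x).1 (fun _ => g) = Finsupp.linearCombination (ZMod p) (Γ.coord g) x := by
  induction x using Finsupp.induction_linear with
  | zero => simp
  | add x y hx hy => rw [map_add, map_add, ← hx, ← hy]; rfl
  | single v r =>
    rw [Finsupp.linearCombination_single, ← Finsupp.smul_single_one, map_smul]
    rfl

/-! ### The cup product in degree 2 -/

/-- The cup product of the `1`-cocycles of `G_Γ`. -/
noncomputable def cupTensor [Finite V] :
    (V →₀ ZMod p) ⊗[ZMod p] (V →₀ ZMod p) →ₗ[ZMod p] Z (ZMod p) Γ.RAAG (1 + 1) :=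
  TensorProduct.lift ((cupZ (ZMod p) Γ.RAAG 1 1).compl₁₂ Γ.cocycleEquiv.toLinearMap
    Γ.cocycleEquiv.toLinearMap)

theorem ev_cupTensor [Finite V] (t : (V →₀ ZMod p) ⊗[ZMod p] (V →₀ ZMod p)) (s : ℕ → Γ.RAAG) :
    ev (Γ.cupTensor t).1 s = tensorForm t (Γ.coord (s 0)) (Γ.coord (s 1)) := by
  induction t with
  | zero => simp [ev]
  | tmul x y =>
    rw [tensorForm_tmul, ← cocycleEquiv_apply, ← cocycleEquiv_apply]
    refine (ev_cup _ _ _).trans ?_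
    simp [ev]
  | add x y hx hy =>
    rw [map_add, map_add, LinearMap.add_apply, LinearMap.add_apply, ← hx, ← hy]
    rfl

/-- A cochain `φ` bounds the cocycle precisely when `g ↦ (-φ g, coord g)` is a homomorphism to
`BilinExt (tensorForm t)`. Such a lift of `coord` exists if and only if the lifts of adjacent
vertices commute, that is, if the form is symmetric at each edge. -/
theorem cupTensor_mem_B_iff [Finite V] [DecidableEq V]
    (t : (V →₀ ZMod p) ⊗[ZMod p] (V →₀ ZMod p)) :
    (Γ.cupTensor t).1 ∈ B (ZMod p) Γ.RAAG (1 + 1) ↔ Γ.SymmOnEdges t := by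
  rw [mem_B_two_iff]
  constructor
  · rintro ⟨φ, hφ⟩ v w hvw
    let θ : Γ.RAAG →* BilinExt (tensorForm t) :=
      MonoidHom.mk' (fun g => ⟨-φ fun _ => g, Γ.coord g⟩) fun g h => by
        rw [BilinExt.mul_def, BilinExt.mk.injEq, coord_mul]
        have := hφ fun n => if n = 0 then g else h
        rw [ev_cupTensor] at this
        simp only [one_ne_zero, if_true, if_false] at this
        exact ⟨by linear_combination -this, rfl⟩
    have hθ : Continuous θ := by
      -- Since `V` is finite, the coordinates assemble into a single locally constant map; this
      -- gives the continuity of `θ`.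
      let X : LocallyConstant (Fin 1 → Γ.RAAG) (V → ZMod p) :=
        LocallyConstant.unflip fun v => (Γ.cocycleEquiv (Finsupp.single v 1)).1
      exact (((φ.isLocallyConstant.prodMk X.isLocallyConstant).comp fun r =>
        (⟨-r.1, r.2⟩ : BilinExt (tensorForm t))).continuous).comp
          (continuous_pi fun _ => continuous_id : Continuous fun (g : Γ.RAAG) (_ : Fin 1) => g)
    have := gen_comm hθ BilinExt.pow_labelExp hvw
    rw [BilinExt.mul_comm_iff] at this
    simpa [θ, coord_gen] using this
  · intro h
    -- The central coordinate 0 is an arbitrary choice: it does not affect commutation.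
    obtain ⟨θ, hθ, hv⟩ := exists_hom (Γ := Γ) BilinExt.pow_labelExp (fun v =>
      (⟨0, Pi.single v 1⟩ : BilinExt (tensorForm t)))
      (fun v w hvw => (BilinExt.mul_comm_iff _ _).2 (h v w hvw))
    -- `θ` is prescribed on the vertices only. Each coordinate of its image in `𝔽_p^V` is a
    -- 1-cocycle, so `evalGen_injective` identifies it with that of `coord`.
    have hx : ∀ g, (θ g).x = Γ.coord g := fun g => funext fun v => by
      obtain ⟨a, ha⟩ := Γ.exists_cochain hθ fun b => b.x v
      have haZ : a ∈ Z (ZMod p) Γ.RAAG 1 := mem_Z_one_iff.2 fun g h => by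
        rw [ha, ha, ha, map_mul]
        rfl
      have : (⟨a, haZ⟩ : Z (ZMod p) Γ.RAAG 1) = Γ.cocycleEquiv (Finsupp.single v 1) := by
        refine Γ.evalGen_injective (funext fun w => ?_)
        refine Eq.trans ?_ (Γ.cocycleEquiv_gen _ _).symm
        change a _ = _
        rw [ha, hv, Finsupp.single_apply]
        change Pi.single w 1 v = _
        rw [Pi.single_apply]
      rw [coord, ← this]
      exact (ha fun _ => g).symm
    obtain ⟨φ, hφ⟩ := Γ.exists_cochain hθ fun b => -b.c
    refine ⟨φ, fun s => ?_⟩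
    rw [ev_cupTensor, hφ, hφ, hφ, map_mul, BilinExt.mul_def, hx, hx]
    ring

/-- `H¹(G_Γ, 𝔽_p)` has a basis indexed by the vertices. -/
noncomputable def degreeOneEquiv [Finite V] :
    (V →₀ ZMod p) ≃ₗ[ZMod p] degreePart (ZMod p) Γ.RAAG 1 :=
  LinearEquiv.ofBijective
    ((DirectSum.lof (ZMod p) ℕ (H (ZMod p) Γ.RAAG) 1).rangeRestrict ∘ₗ cls (ZMod p) Γ.RAAG 1 ∘ₗ
      Γ.cocycleEquiv.toLinearMap) (by
    constructor
    · refine (injective_iff_map_eq_zero _).2 fun x hx => ?_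
      have h1 : DirectSum.lof (ZMod p) ℕ (H (ZMod p) Γ.RAAG) 1
          (cls (ZMod p) Γ.RAAG 1 (Γ.cocycleEquiv x)) = 0 := congrArg Subtype.val hx
      rw [← map_zero (DirectSum.lof (ZMod p) ℕ (H (ZMod p) Γ.RAAG) 1)] at h1
      obtain ⟨a, ha⟩ := (cls_eq_zero_iff _ _ _).1 (DirectSum.of_injective 1 h1)
      refine Γ.cocycleEquiv.map_eq_zero_iff.1 (Subtype.ext (ev_ext fun s => ?_))
      -- There are no nonzero 1-coboundaries: a 0-cochain reads no entries, so its two faces agree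
      -- and cancel.
      rw [← ha, ev_d, Finset.sum_range_succ, Finset.sum_range_one,
        ev_congr a (g := face 1 s) (g' := face 0 s) fun i hi => absurd hi (Nat.not_lt_zero i)]
      simp [ev]
    · exact (LinearMap.surjective_rangeRestrict _).comp
        ((cls_surjective _ _ _).comp Γ.cocycleEquiv.surjective))

theorem sqMap_degreeOneEquiv [Finite V] (t : (V →₀ ZMod p) ⊗[ZMod p] (V →₀ ZMod p)) :
    sqMap ((degreePart (ZMod p) Γ.RAAG 1).subtype ∘ₗ Γ.degreeOneEquiv.toLinearMap) t =
      DirectSum.lof (ZMod p) ℕ (H (ZMod p) Γ.RAAG) (1 + 1)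
        (cls (ZMod p) Γ.RAAG (1 + 1) (Γ.cupTensor t)) := by
  induction t with
  | zero => simp
  | tmul x y => exact DirectSum.of_mul_of _ _
  | add x y hx hy => simp only [map_add, hx, hy]

theorem sqMap_degreeOneEquiv_eq_zero_iff [Finite V] [DecidableEq V]
    (t : (V →₀ ZMod p) ⊗[ZMod p] (V →₀ ZMod p)) :
    sqMap ((degreePart (ZMod p) Γ.RAAG 1).subtype ∘ₗ Γ.degreeOneEquiv.toLinearMap) t = 0 ↔
      Γ.SymmOnEdges t := by
  rw [sqMap_degreeOneEquiv, ← cupTensor_mem_B_iff, ← cls_eq_zero_iff]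
  refine ⟨fun h => DirectSum.of_injective (β := H (ZMod p) Γ.RAAG) (1 + 1) ?_, fun h => ?_⟩
  · exact h.trans (map_zero _).symm
  · rw [h, map_zero]

end PGraph

theorem theoremE (p : ℕ) [Fact p.Prime] {V : Type*} [Finite V] (Γ : PGraph p V)
    (hΓ : IsHQuadratic p Γ.RAAG) :
    QuadAlg.GradedIso (ContCoh.degreePart (ZMod p) Γ.RAAG) Γ.exteriorOpDegree := by
  classical
  exact QuadAlg.IsQuadratic.gradedIso hΓ Γ.degreeOneEquiv
    (fun ω hω => (Γ.sqMap_degreeOneEquiv_eq_zero_iff ω).2 (PGraph.symmOnEdges_of_mem hω))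
    (fun t ht => PGraph.sqMap_ι_eq_zero ((Γ.sqMap_degreeOneEquiv_eq_zero_iff t).1 ht))
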